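/- Let $F$ be a perfect field of characteristic $2$ (for example, any finite field of characteristic $2$) with at least four elements. Then every square matrix $A$ over $F$ can be written as $A = N + D$, where $N$ and $D$ are square matrices over $F$ of the same size as $A$, $N^2 = 0$, and $D$ is diagonalizable over $F$, i.e. there is an invertible matrix $U$ over $F$ such that $U^{-1} D U$ is diagonal. -/

import Mathlib

/-- A square matrix `M` over a field is diagonalizable if there is an invertible matrix `U` such
that `U⁻¹ * M * U` is a diagonal matrix. -/
def IsDiagonalizable {F : Type*} [Field F] {n : ℕ} (M : Matrix (Fin n) (Fin n) F) : Prop :=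
  ∃ U : Matrix (Fin n) (Fin n) F, IsUnit U ∧ (U⁻¹ * M * U).IsDiag

/-!
A matrix `A` makes `Fⁿ` a torsion module over the principal ideal domain `F[X]`, hence a finite
direct sum of cyclic modules `F[X] ⧸ (p)`. Decompositions `N + D` add up over direct sums
(`HasDecomp.directSum`), so it suffices to decompose multiplication by the root `x` on
`F[X] ⧸ (q) = AdjoinRoot q`, where `q` is monic of degree `m + 1`.

For nodes `d 0, …, d m`, the Newton polynomials `∏_{j < i} (X - d j)` give a basis `v 0, …, v m` with
`x • v i = d i • v i + v (i + 1)` for `i < m`. Let `N` send `v i` to `v (i + 1)` for every second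
`i`, namely `i = m - 1, m - 3, …`, and kill the other basis vectors. Then `N ^ 2 = 0`, and
`D = x - N` is block triangular: apart from the last column it consists of blocks of size at most
two with eigenvalues among the `d i`. If the two nodes of a block are always distinct, if `d m`
differs from all other nodes, and if the nodes sum to the trace of `x` (so that the last diagonal
entry is `d m`), then `D` is diagonalizable; this is `hasDecomp_root_of_nodes`.

With four elements in a field of characteristic two such nodes exist (`exists_nodes`): each pair
`a, a + 1` contributes `1` to the sum, and a few free nodes correct the total. The only exception is
degree two and trace zero, because two distinct nodes cannot sum to zero. There `q = X ^ 2 + c`, and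
since `F` is perfect `c = r ^ 2`, so that `x = (x - r) + r` is a decomposition.
-/

open Polynomial Module

/-! ### Decompositions of endomorphisms -/

/-- The endomorphism `f` is the sum of an endomorphism of square zero and a diagonalizable one.
Diagonalizability is expressed by the eigenspaces spanning the whole space. -/
def HasDecomp {F V : Type*} [Field F] [AddCommGroup V] [Module F V] (f : End F V) : Prop :=
  ∃ N D : End F V, N ^ 2 = 0 ∧ (⨆ μ, D.eigenspace μ) = ⊤ ∧ f = N + D

section Transfer

variable {F V W : Type*} [Field F] [AddCommGroup V] [Module F V] [AddCommGroup W] [Module F W]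

theorem HasDecomp.of_equiv {f : End F V} {g : End F W} (e : V ≃ₗ[F] W)
    (h : ∀ x, e (f x) = g (e x)) (hg : HasDecomp g) : HasDecomp f := by
  obtain ⟨N, D, hN, hD, rfl⟩ := hg
  refine ⟨e.symm.conj N, e.symm.conj D, ?_, ?_, ?_⟩
  · ext x
    have := LinearMap.congr_fun hN (e x)
    simp only [pow_two, Module.End.mul_apply, LinearMap.zero_apply] at this
    simp [pow_two, LinearEquiv.conj_apply, this]
  · have hle : (⨆ μ, D.eigenspace μ) ≤
        (⨆ μ, (e.symm.conj D).eigenspace μ).comap (e.symm : W →ₗ[F] V) := by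
      refine iSup_le fun μ x hx => ?_
      refine Submodule.mem_iSup_of_mem (p := (e.symm.conj D).eigenspace) μ ?_
      rw [End.mem_eigenspace_iff] at hx ⊢
      simp [LinearEquiv.conj_apply, hx]
    rw [hD] at hle
    refine eq_top_iff.2 fun x _ => ?_
    simpa using hle (Submodule.mem_top (x := e x))
  · ext x
    apply e.injective
    simp [h, LinearEquiv.conj_apply]

theorem HasDecomp.directSum {ι : Type*} {M : ι → Type*} [∀ i, AddCommGroup (M i)]
    [∀ i, Module F (M i)] {f : ∀ i, End F (M i)} (h : ∀ i, HasDecomp (f i)) :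
    HasDecomp (DirectSum.lmap f) := by
  classical
  choose N D hN hD hf using h
  refine ⟨DirectSum.lmap N, DirectSum.lmap D, ?_, ?_, ?_⟩
  · ext i x j
    have := LinearMap.congr_fun (hN i) x
    simp only [pow_two, Module.End.mul_apply, LinearMap.zero_apply] at this
    simp [pow_two, this]
  · refine eq_top_iff.2 fun x _ => ?_
    induction x using DirectSum.induction_on with
    | zero => exact zero_mem _
    | add x y hx hy => exact add_mem (hx trivial) (hy trivial)
    | of i x =>
      have hle : (⨆ μ, (D i).eigenspace μ) ≤
          (⨆ μ, End.eigenspace (DirectSum.lmap D) μ).comap (DirectSum.lof F ι M i) := by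
        refine iSup_le fun μ y hy => ?_
        refine Submodule.mem_iSup_of_mem (p := End.eigenspace (DirectSum.lmap D)) μ ?_
        rw [End.mem_eigenspace_iff] at hy ⊢
        simp [hy]
      rw [hD i] at hle
      exact hle (Submodule.mem_top (x := x))
  · ext i x : 2
    simp [hf i]

end Transfer

/-! ### Diagonalizable matrices -/

section Matrix

variable {F : Type*} [Field F]

theorem isDiagonalizable_of_iSup_eigenspace_eq_top {n : ℕ} {M : Matrix (Fin n) (Fin n) F}
    (h : (⨆ μ, End.eigenspace (Matrix.toLin' M) μ) = ⊤) : IsDiagonalizable M := by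
  set s : Set (Fin n → F) := {x | ∃ μ, x ∈ End.eigenspace (Matrix.toLin' M) μ} with hs
  have hspan : Submodule.span F s = ⊤ := by
    rw [eq_top_iff, ← h]
    exact iSup_le fun μ x hx => Submodule.subset_span ⟨μ, hx⟩
  obtain ⟨b, hbs, hb, hli⟩ := exists_linearIndependent F s
  let B : Basis b F (Fin n → F) := Basis.mk hli (by simp [hb, hspan])
  have : Fintype b := FiniteDimensional.fintypeBasisIndex B
  have hcard : Fintype.card b = n := by
    rw [← finrank_eq_card_basis B, finrank_fin_fun]
  let B' : Basis (Fin n) F (Fin n → F) := B.reindex (Fintype.equivFinOfCardEq hcard)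
  have hB' : ∀ j, ∃ μ : F, M.mulVec (B' j) = μ • B' j := by
    intro j
    obtain ⟨μ, hμ⟩ := hbs ((Fintype.equivFinOfCardEq hcard).symm j).2
    rw [End.mem_eigenspace_iff, Matrix.toLin'_apply] at hμ
    exact ⟨μ, by simpa [B', B] using hμ⟩
  choose μ hμ using hB'
  let U : Matrix (Fin n) (Fin n) F := (Pi.basisFun F (Fin n)).toMatrix B'
  have hU : IsUnit U := by
    have := (Pi.basisFun F (Fin n)).invertibleToMatrix B'
    exact isUnit_of_invertible U
  have hMU : M * U = U * Matrix.diagonal μ := by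
    ext i j
    have := congrFun (hμ j) i
    rw [Matrix.mul_diagonal]
    simpa [U, Matrix.mul_apply, Matrix.mulVec, dotProduct, Basis.toMatrix_apply,
      mul_comm] using this
  refine ⟨U, hU, ?_⟩
  rw [mul_assoc, hMU, ← mul_assoc, Matrix.nonsing_inv_mul _ ((Matrix.isUnit_iff_isUnit_det U).1 hU),
    one_mul]
  exact Matrix.isDiag_diagonal μ

end Matrix

/-! ### Newton bases of cyclic modules -/

section Newton

variable {F : Type*} [Field F]

/-- The `i`-th Newton polynomial `∏_{j < i} (X - d j)` for the nodes `d`. -/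
noncomputable def newton (d : ℕ → F) (i : ℕ) : F[X] := ∏ j ∈ Finset.range i, (X - C (d j))

theorem newton_monic (d : ℕ → F) (i : ℕ) : (newton d i).Monic :=
  monic_prod_of_monic _ _ fun j _ => monic_X_sub_C (d j)

theorem newton_natDegree (d : ℕ → F) (i : ℕ) : (newton d i).natDegree = i := by
  simp [newton]

/-- The Newton polynomials as a sequence of polynomials, the `i`-th of degree `i`. -/
noncomputable def newtonSequence (d : ℕ → F) : Polynomial.Sequence F where
  elems' := newton d
  degree_eq' i := by
    rw [degree_eq_natDegree (newton_monic d i).ne_zero, newton_natDegree]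

theorem span_newton (d : ℕ → F) (m : ℕ) :
    Submodule.span F (newton d '' Set.Iio m) = degreeLT F m :=
  (newtonSequence d).span_degreeLT fun i _ => by
    rw [show (newtonSequence d i).leadingCoeff = 1 from newton_monic d i]; exact isUnit_one

theorem newton_coeff (d : ℕ → F) (m : ℕ) :
    (newton d (m + 1)).coeff m = -∑ i ∈ Finset.range (m + 1), d i := by
  have := prod_X_sub_C_coeff_card_pred (Finset.range (m + 1)) d (by simp)
  simpa [newton] using this

/-- If the nodes sum to the trace `-q.coeff m`, the two leading coefficients of `q` and of the Newton
polynomial of the same degree agree. -/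
theorem newton_sub_mem_degreeLT (d : ℕ → F) {q : F[X]} (hq : q.Monic) {m : ℕ}
    (hm : q.natDegree = m + 1) (hd : ∑ i ∈ Finset.range (m + 1), d i = -q.coeff m) :
    newton d (m + 1) - q ∈ degreeLT F m := by
  rw [mem_degreeLT, degree_lt_iff_coeff_zero]
  intro k hk
  rw [coeff_sub]
  rcases Nat.lt_trichotomy k (m + 1) with h | rfl | h
  · obtain rfl : k = m := by omega
    rw [newton_coeff, hd]; ring
  · have h1 := (newton_monic d (m + 1)).coeff_natDegree
    have h2 := hq.coeff_natDegree
    rw [newton_natDegree] at h1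
    rw [hm] at h2
    rw [h1, h2, sub_self]
  · rw [coeff_eq_zero_of_natDegree_lt (by rwa [newton_natDegree]),
      coeff_eq_zero_of_natDegree_lt (by omega), sub_self]

theorem mul_newton (d : ℕ → F) (i : ℕ) :
    X * newton d i = newton d (i + 1) + C (d i) * newton d i := by
  rw [newton, newton, Finset.prod_range_succ]; ring

/-- The Newton polynomials of degree less than `q.natDegree` form a basis of `F[X] ⧸ (q)`. -/
theorem exists_newton_basis (d : ℕ → F) {q : F[X]} (hq : q.Monic) {n : ℕ} (hn : q.natDegree = n) :
    ∃ b : Basis (Fin n) F (AdjoinRoot q), ∀ i, b i = AdjoinRoot.mk q (newton d i) := by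
  have hfr : finrank F (AdjoinRoot q) = n := by
    rw [(AdjoinRoot.powerBasis' hq).finrank, AdjoinRoot.powerBasis'_dim, hn]
  have hspan : ⊤ ≤ Submodule.span F (Set.range fun i : Fin n => AdjoinRoot.mk q (newton d i)) := by
    intro x _
    induction x using AdjoinRoot.induction_on with
    | ih p =>
    have hp : p %ₘ q ∈ Submodule.span F (newton d '' Set.Iio n) := by
      rw [span_newton, mem_degreeLT, ← hn, ← degree_eq_natDegree hq.ne_zero]
      exact degree_modByMonic_lt p hq
    have hpq : AdjoinRoot.mk q p = AdjoinRoot.mk q (p %ₘ q) := by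
      rw [AdjoinRoot.mk_eq_mk]
      exact ⟨p /ₘ q, by rw [sub_eq_iff_eq_add, add_comm, modByMonic_add_div p q]⟩
    rw [hpq]
    have := Submodule.mem_map_of_mem (f := (AdjoinRoot.mkₐ q).toLinearMap.restrictScalars F) hp
    rw [Submodule.map_span] at this
    refine Submodule.span_mono ?_ this
    rintro _ ⟨_, ⟨i, hi, rfl⟩, rfl⟩
    exact ⟨⟨i, hi⟩, rfl⟩
  exact ⟨basisOfTopLeSpanOfCardEqFinrank _ hspan (by simp [hfr]), fun i => by simp⟩

/-- Multiplication by the root `x` of `q` is decomposed by taking for `N` the part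
`v i ↦ v (i + 1)`, for `i = m - 1, m - 3, …`, of its matrix in the Newton basis `v`. The condition
`hlast` separates the last basis vector from the others, `hpair` makes the two-dimensional blocks of
`D = x - N` diagonalizable, and `hsum` makes `d m` the last diagonal entry. -/
theorem hasDecomp_root_of_nodes {q : F[X]} (hq : q.Monic) {m : ℕ} (hm : q.natDegree = m + 1)
    (d : ℕ → F) (hlast : ∀ i < m, d i ≠ d m)
    (hpair : ∀ i, i + 1 < m → Odd (i + 1 + m) → d i ≠ d (i + 1))
    (hsum : ∑ i ∈ Finset.range (m + 1), d i = -q.coeff m) :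
    HasDecomp (LinearMap.mulLeft F (AdjoinRoot.root q)) := by
  obtain ⟨b, hb⟩ := exists_newton_basis d hq hm
  set v : ℕ → AdjoinRoot q := fun i => AdjoinRoot.mk q (newton d i) with hv
  set f : End F (AdjoinRoot q) := LinearMap.mulLeft F (AdjoinRoot.root q) with hfdef
  have hf : ∀ i, f (v i) = v (i + 1) + d i • v i := by
    intro i
    have := congrArg (AdjoinRoot.mk q) (mul_newton d i)
    simpa [hv, hfdef, Algebra.smul_def, AdjoinRoot.algebraMap_eq] using this
  let N : End F (AdjoinRoot q) :=
    b.constr F fun i => if (i : ℕ) < m ∧ Odd ((i : ℕ) + m) then v (i + 1) else 0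
  have hN : ∀ i ≤ m, N (v i) = if i < m ∧ Odd (i + m) then v (i + 1) else 0 := by
    intro i hi
    have := b.constr_basis F (fun i : Fin (m + 1) =>
      if (i : ℕ) < m ∧ Odd ((i : ℕ) + m) then v (i + 1) else 0) ⟨i, by omega⟩
    rwa [hb] at this
  set D : End F (AdjoinRoot q) := f - N with hD
  set E : Submodule F (AdjoinRoot q) := ⨆ μ, D.eigenspace μ
  have hmemE : ∀ (μ : F) (x : AdjoinRoot q), D x = μ • x → x ∈ E := fun μ x hx =>
    Submodule.mem_iSup_of_mem (p := D.eigenspace) μ (End.mem_eigenspace_iff.2 hx)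
  have hDS : ∀ i < m, Odd (i + m) → D (v i) = d i • v i := fun i hi ho => by
    rw [hD, LinearMap.sub_apply, hf, hN i hi.le, if_pos ⟨hi, ho⟩, add_sub_cancel_left]
  have hDn : ∀ i ≤ m, ¬ Odd (i + m) → D (v i) = v (i + 1) + d i • v i := fun i hi ho => by
    rw [hD, LinearMap.sub_apply, hf, hN i hi, if_neg (fun h => ho h.2), sub_zero]
  -- an eigenvector for an eigenvalue other than `d m` lies in the image of `E` under `D - d m`
  have himg : ∀ (μ : F) (x : AdjoinRoot q), μ ≠ d m → D x = μ • x →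
      x ∈ E ⊓ E.map (D - algebraMap F (End F (AdjoinRoot q)) (d m)) := fun μ x hμ hx => by
    refine ⟨hmemE μ x hx, (μ - d m)⁻¹ • x, E.smul_mem _ (hmemE μ x hx), ?_⟩
    rw [map_smul, LinearMap.sub_apply, hx, Module.algebraMap_end_apply, ← sub_smul,
      inv_smul_smul₀ (sub_ne_zero.2 hμ)]
  have hvlt : ∀ i < m, v i ∈ E ⊓ E.map (D - algebraMap F (End F (AdjoinRoot q)) (d m)) := by
    intro i hi
    by_cases ho : Odd (i + m)
    · exact himg _ _ (hlast i hi) (hDS i hi ho)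
    -- `v i` and `v (i + 1)` span a block of `D` with the distinct eigenvalues `d i`, `d (i + 1)`
    · have ho' : Odd (i + 1 + m) := by
        rw [Nat.not_odd_iff_even] at ho
        rw [add_right_comm]; exact ho.add_one
      have hi' : i + 1 < m := by
        rcases Nat.lt_or_ge (i + 1) m with h | h
        · exact h
        · obtain rfl : m = i + 1 := by omega
          exact absurd ho' (by simp)
      have hne : d i - d (i + 1) ≠ 0 := sub_ne_zero.2 (hpair i hi' ho')
      have h1 := himg _ _ (hlast (i + 1) hi') (hDS (i + 1) hi' ho')
      have h2 : v i + (d i - d (i + 1))⁻¹ • v (i + 1) ∈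
          E ⊓ E.map (D - algebraMap F (End F (AdjoinRoot q)) (d m)) := by
        refine himg (d i) _ (hlast i hi) ?_
        have : v (i + 1) = (d i - d (i + 1)) • (d i - d (i + 1))⁻¹ • v (i + 1) :=
          (smul_inv_smul₀ hne _).symm
        rw [map_add, map_smul, hDn i hi.le ho, hDS _ hi' ho']
        nth_rewrite 1 [this]
        module
      have := Submodule.sub_mem _ h2 (Submodule.smul_mem _ (d i - d (i + 1))⁻¹ h1)
      rwa [add_sub_cancel_right] at this
  -- modulo `q`, `v (m + 1)` is a combination of `v 0, …, v (m - 1)`, by the condition on the sum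
  have hvm : v (m + 1) ∈ E.map (D - algebraMap F (End F (AdjoinRoot q)) (d m)) := by
    have hmem := newton_sub_mem_degreeLT d hq hm hsum
    rw [← span_newton d] at hmem
    have := Submodule.mem_map_of_mem (f := (AdjoinRoot.mkₐ q).toLinearMap.restrictScalars F) hmem
    rw [Submodule.map_span] at this
    have hv' : (AdjoinRoot.mkₐ q).toLinearMap.restrictScalars F (newton d (m + 1) - q)
        = v (m + 1) := by
      change AdjoinRoot.mk q _ = _
      rw [map_sub, AdjoinRoot.mk_self, sub_zero]
    rw [hv'] at this
    refine Submodule.span_le.2 ?_ this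
    rintro _ ⟨_, ⟨i, hi, rfl⟩, rfl⟩
    exact (hvlt i hi).2
  have hvE : ∀ i ≤ m, v i ∈ E := by
    intro i hi
    rcases hi.lt_or_eq with hi | rfl
    · exact (hvlt i hi).1
    -- correcting `v m` by a `w ∈ E` with `(D - d m) w = v (m + 1)` gives an eigenvector
    · obtain ⟨w, hw, hw'⟩ := hvm
      have h1 : v i - w ∈ E := by
        refine hmemE (d i) _ ?_
        rw [LinearMap.sub_apply, Module.algebraMap_end_apply] at hw'
        rw [map_sub, hDn i le_rfl (by simp), ← hw']
        module
      simpa using add_mem h1 hw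
  refine ⟨N, D, ?_, ?_, by rw [hD]; abel⟩
  · refine b.ext fun i => ?_
    have hbi : b i = v i := hb i
    rw [pow_two, End.mul_apply, hbi, hN i (by omega), LinearMap.zero_apply]
    split_ifs with h
    · rw [hN _ h.1, if_neg]
      rintro ⟨-, h'⟩
      have h'' := h.2.add_one
      rw [add_right_comm] at h''
      exact Nat.not_even_iff_odd.2 h' h''
    · exact map_zero _
  · rw [eq_top_iff, ← b.span_eq, Submodule.span_le]
    rintro _ ⟨i, rfl⟩
    rw [hb]
    exact hvE i (by omega)

end Newton

/-! ### Choosing the nodes -/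

section Nodes

theorem exists_ne_three {α : Type*} (hα : 4 ≤ Cardinal.mk α) (a b c : α) :
    ∃ x, x ≠ a ∧ x ≠ b ∧ x ≠ c := by
  classical
  by_contra! h
  have h1 : (Set.univ : Set α) ⊆ (({a, b, c} : Finset α) : Set α) := by
    intro x _
    have := h x
    simp only [Finset.coe_insert, Finset.coe_singleton, Set.mem_insert_iff, Set.mem_singleton_iff]
    tauto
  have h2 := Cardinal.mk_le_mk_of_subset h1
  rw [Cardinal.mk_univ, Finset.coe_sort_coe, Cardinal.mk_coe_finset] at h2
  have h3 : (4 : Cardinal) ≤ ((3 : ℕ) : Cardinal) :=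
    (hα.trans h2).trans (by exact_mod_cast Finset.card_le_three)
  norm_cast at h3

variable {F : Type*} [Field F] [CharP F 2]

theorem sum_alternating (a : F) (k : ℕ) :
    ∑ i ∈ Finset.range (2 * k), (if Even i then a else a + 1) = k := by
  induction k with
  | zero => simp
  | succ k ih =>
    rw [show 2 * (k + 1) = 2 * k + 1 + 1 by ring, Finset.sum_range_succ, Finset.sum_range_succ, ih,
      if_pos (by simp), if_neg (by simp)]
    push_cast
    linear_combination CharTwo.add_self_eq_zero a

/-- Nodes as required by `hasDecomp_root_of_nodes`, for any prescribed sum `t`. The excluded case is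
`m = 1`, `t = 0`, where `d 0 + d 1 = 0` would force `d 0 = d 1`. -/
theorem exists_nodes (hF : 4 ≤ Cardinal.mk F) (m : ℕ) (t : F) (hmt : m ≠ 1 ∨ t ≠ 0) :
    ∃ d : ℕ → F, (∀ i < m, d i ≠ d m) ∧ (∀ i, i + 1 < m → Odd (i + 1 + m) → d i ≠ d (i + 1)) ∧
      ∑ i ∈ Finset.range (m + 1), d i = t := by
  rcases Nat.even_or_odd' m with ⟨k, rfl | rfl⟩
  -- for even `m` the other nodes are `m / 2` pairs `a, a + 1`, and `d m` takes up the rest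
  · obtain ⟨a, ha, ha', -⟩ := exists_ne_three hF (t - k) (t - k - 1) 0
    refine ⟨fun i => if i = 2 * k then t - k else if Even i then a else a + 1, ?_, ?_, ?_⟩
    · intro i hi
      simp only [hi.ne, if_false, if_true]
      split_ifs
      · exact ha
      · exact fun h => ha' (by rw [← h]; ring)
    · intro i hi ho
      have hi0 : Even i := by
        simp only [Nat.odd_iff] at ho
        simp only [Nat.even_iff]; omega
      simp [show i ≠ 2 * k by omega, hi.ne, hi0, Nat.even_add_one]
    · rw [Finset.sum_range_succ, if_pos rfl]
      rw [Finset.sum_congr rfl (g := fun i => if Even i then a else a + 1)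
        (fun i hi => if_neg (Finset.mem_range.1 hi).ne), sum_alternating]
      ring
  · rcases k with _ | k
    · have ht : t ≠ 0 := by simpa using hmt
      refine ⟨fun i => if i = 0 then t else 0, ?_, ?_, ?_⟩
      · intro i hi
        obtain rfl : i = 0 := by omega
        simpa using ht
      · intro i hi; omega
      · simp
    -- for odd `m ≥ 3` the nodes are `x`, a pair `y, y + s`, then `k` pairs `a, a + 1`, and `d m = 0`;
    -- `x` is chosen such that both `x` and the difference `s` needed for the sum are nonzero
    · obtain ⟨x, hx, hx', -⟩ := exists_ne_three hF 0 (t - k) 0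
      obtain ⟨y, hy, hy', -⟩ := exists_ne_three hF 0 (x - (t - k)) 0
      obtain ⟨a, ha, ha', -⟩ := exists_ne_three hF 0 1 0
      have h11 : (1 : F) + 1 = 0 := CharTwo.add_self_eq_zero 1
      set s : F := t - k - x with hs
      have hs0 : s ≠ 0 := fun h => hx' (by rw [← sub_eq_zero, ← neg_eq_zero, ← h, hs]; ring)
      refine ⟨fun i => if i = 2 * (k + 1) + 1 then 0 else if i = 0 then x else if i = 1 then y
        else if i = 2 then y + s else if Even (i - 3) then a else a + 1, ?_, ?_, ?_⟩
      · intro i hi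
        simp only [hi.ne, if_false, if_true]
        split_ifs
        · exact hx
        · exact hy
        · exact fun h => hy' (by rw [hs] at h; linear_combination h)
        · exact ha
        · exact fun h => ha' (by linear_combination h - h11)
      · intro i hi ho
        simp only [Nat.odd_iff] at ho
        have h0 : i ≠ 0 := by omega
        have h2 : i ≠ 2 := by omega
        by_cases h1 : i = 1
        · subst h1
          simpa [show k ≠ 0 ∨ k = 0 by omega] using hs0
        · have hev : Even (i - 3) := by rw [Nat.even_iff]; omega
          have hev' : ¬ Even (i + 1 - 3) := by rw [Nat.even_iff]; omega
          beta_reduce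
          rw [if_neg (by omega), if_neg h0, if_neg h1, if_neg h2, if_pos hev, if_neg hi.ne,
            if_neg (by omega), if_neg (by omega), if_neg (by omega), if_neg hev']
          simp
      · rw [Finset.sum_range_succ, if_pos rfl, add_zero,
          show 2 * (k + 1) + 1 = 3 + 2 * k by ring, Finset.sum_range_add,
          Finset.sum_congr (s₁ := Finset.range (2 * k)) rfl
            (g := fun i => if Even i then a else a + 1), sum_alternating]
        · simp only [Finset.sum_range_succ, Finset.range_zero, Finset.sum_empty]
          simp only [show (0 : ℕ) ≠ 3 + 2 * k by omega, show (1 : ℕ) ≠ 3 + 2 * k by omega,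
            show (2 : ℕ) ≠ 3 + 2 * k by omega, show (2 : ℕ) ≠ 1 by omega, one_ne_zero, two_ne_zero,
            if_true, if_false, hs]
          linear_combination CharTwo.add_self_eq_zero y
        · intro i hi
          have := Finset.mem_range.1 hi
          rw [if_neg (by omega), if_neg (by omega), if_neg (by omega), if_neg (by omega),
            Nat.add_sub_cancel_left]

end Nodes

/-! ### Cyclic modules and the general case -/

section Cyclic

variable {F : Type*} [Field F] [CharP F 2] [PerfectField F]

/-- Multiplication by the root on `F[X] ⧸ (q)` has a decomposition; for `q = X ^ 2 + c`, where no
nodes exist, `q` is the square of `X - r` because `F` is perfect. -/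
theorem hasDecomp_root (hF : 4 ≤ Cardinal.mk F) {q : F[X]} (hq : q.Monic) :
    HasDecomp (LinearMap.mulLeft F (AdjoinRoot.root q)) := by
  rcases hm : q.natDegree with _ | m
  -- for `q = 1` the quotient is the zero ring
  · have : Subsingleton (AdjoinRoot q) := by
      rw [eq_one_of_monic_natDegree_zero hq hm]
      refine ⟨fun x y => ?_⟩
      have h1 : (1 : AdjoinRoot (1 : F[X])) = 0 := by
        rw [← map_one (AdjoinRoot.mk (1 : F[X])), AdjoinRoot.mk_self]
      rw [← one_mul x, ← one_mul y, h1, zero_mul, zero_mul]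
    exact ⟨0, 0, Subsingleton.elim _ _, Subsingleton.elim _ _, Subsingleton.elim _ _⟩
  by_cases h : m ≠ 1 ∨ -q.coeff m ≠ 0
  · obtain ⟨d, h1, h2, h3⟩ := exists_nodes hF m _ h
    exact hasDecomp_root_of_nodes hq hm d h1 h2 h3
  · push Not at h
    obtain ⟨rfl, h⟩ := h
    have : ExpChar F 2 := ExpChar.prime Nat.prime_two
    obtain ⟨r, hr⟩ := surjective_frobenius F 2 (q.coeff 0)
    rw [frobenius_def] at hr
    have hq2 : q = (X - C r) ^ 2 := by
      have h2 := hq.coeff_natDegree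
      rw [hm] at h2
      have h11 : (2 : F[X]) = 0 := CharTwo.two_eq_zero
      rw [q.as_sum_range_C_mul_X_pow, hm]
      simp [Finset.sum_range_succ, h2, neg_eq_zero.1 h, ← hr]
      linear_combination (X * C r) * h11
    refine ⟨LinearMap.mulLeft F (AdjoinRoot.root q - algebraMap F _ r), algebraMap F _ r,
      ?_, ?_, ?_⟩
    · rw [LinearMap.pow_mulLeft]
      have : (AdjoinRoot.root q - algebraMap F _ r) ^ 2 = AdjoinRoot.mk q ((X - C r) ^ 2) := by
        simp [AdjoinRoot.algebraMap_eq]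
      rw [this, ← hq2, AdjoinRoot.mk_self, LinearMap.mulLeft_zero_eq_zero]
    · refine eq_top_iff.2 fun x _ => Submodule.mem_iSup_of_mem (p := End.eigenspace _) r ?_
      rw [End.mem_eigenspace_iff, Module.algebraMap_end_apply]
    · ext x
      simp [sub_mul, Algebra.smul_def]

theorem hasDecomp_quotient (hF : 4 ≤ Cardinal.mk F) {p : F[X]} (hp : p ≠ 0) :
    HasDecomp (LinearMap.lsmul F[X] (F[X] ⧸ F[X] ∙ p) X |>.restrictScalars F) := by
  classical
  have hspan : (F[X] ∙ p) = Ideal.span {normalize p} :=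
    Ideal.span_singleton_eq_span_singleton.2 (associated_normalize p)
  refine (hasDecomp_root hF (monic_normalize hp)).of_equiv
    ((Submodule.quotEquivOfEq _ _ hspan).restrictScalars F) fun x => ?_
  obtain ⟨g, rfl⟩ := Submodule.Quotient.mk_surjective _ x
  rfl

theorem hasDecomp_end (hF : 4 ≤ Cardinal.mk F) {V : Type*} [AddCommGroup V] [Module F V]
    [FiniteDimensional F V] (f : End F V) : HasDecomp f := by
  have htors : Module.IsTorsion F[X] (AEval' f) := AEval.isTorsion_of_finiteDimensional F V f
  obtain ⟨ι, _, p, hp, e, ⟨φ⟩⟩ := Module.equiv_directSum_of_isTorsion htors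
  have hD := HasDecomp.directSum (F := F) fun i =>
    hasDecomp_quotient hF (pow_ne_zero (e i) (hp i).ne_zero)
  refine hD.of_equiv ((AEval'.of f).trans (φ.restrictScalars F)) fun x => ?_
  have : φ (AEval'.of f (f x)) = (X : F[X]) • φ (AEval'.of f x) := by
    rw [← map_smul, AEval'.X_smul_of]
  refine this.trans ?_
  ext i
  rfl

end Cyclic

theorem theorem3p1 {F : Type*} [Field F] [CharP F 2] [PerfectField F]
    (hF : 4 ≤ Cardinal.mk F) (n : ℕ) (A : Matrix (Fin n) (Fin n) F) :
    ∃ N D : Matrix (Fin n) (Fin n) F, N ^ 2 = 0 ∧ IsDiagonalizable D ∧ A = N + D := by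
  obtain ⟨N, D, hN, hD, hA⟩ := hasDecomp_end hF (Matrix.toLin' A)
  refine ⟨LinearMap.toMatrix' N, LinearMap.toMatrix' D, ?_, ?_, ?_⟩
  · rw [pow_two, ← LinearMap.toMatrix'_mul, ← pow_two, hN, map_zero]
  · exact isDiagonalizable_of_iSup_eigenspace_eq_top (by rwa [Matrix.toLin'_toMatrix'])
  · rw [← map_add, ← hA, LinearMap.toMatrix'_toLin']
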